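/- Let $\mathbb K$ be an algebraically closed field of characteristic zero, let $A$ be an $m\times n$ matrix of non-negative integers whose columns $\varsigma_1,\dots,\varsigma_n\in\mathbb N^m$ are all non-zero, and let $R=\mathbb K[e_1,\dots,e_n]$. Let $\varphi_A:R\to\mathbb K[x_1,\dots,x_m]$ be the $\mathbb K$-algebra homomorphism with $\varphi_A(e_i)=x^{\varsigma_i}$ for all $i$, let $I_A=\ker\varphi_A$ be the toric ideal of $A$, and let $\boldsymbol m=e_1\cdots e_n$. Then $$\left(I_A^{2}:\boldsymbol m^{\infty}\right)=I_A^{(2)}.$$ Here $\left(J:\boldsymbol m^{\infty}\right)=\{f\in R : f\boldsymbol m^a\in J \text{ for some integer } a\ge 0\}$ is the saturation of an ideal $J$ by $\boldsymbol m$, and $I^{(k)}=\bigcap_{\mathfrak q}\left(I^kR_{\mathfrak q}\cap R\right)$, the intersection being over the minimal primes $\mathfrak q$ of $I$, is the $k$-th symbolic power of $I$ (as $I_A$ is prime, $I_A^{(2)}=I_A^2R_{I_A}\cap R$). -/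

import Mathlib

namespace ToricSymbolic

open MvPolynomial

/-- The ring homomorphism `φ_A : K[e₁, …, eₙ] → K[x₁, …, xₘ]` over `K` with `φ_A(eᵢ) = x ^ ςᵢ`, where
`ςᵢ` is the `i`-th column of the matrix `A` of non-negative integers. -/
noncomputable def toricMap (K : Type*) [Field K] {m n : ℕ} (A : Matrix (Fin m) (Fin n) ℕ) :
    MvPolynomial (Fin n) K →ₐ[K] MvPolynomial (Fin m) K :=
  aeval fun i : Fin n => ∏ j : Fin m, (X j : MvPolynomial (Fin m) K) ^ A j i

/-- The toric ideal `I_A = ker φ_A`. -/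
noncomputable def toricIdeal (K : Type*) [Field K] {m n : ℕ} (A : Matrix (Fin m) (Fin n) ℕ) :
    Ideal (MvPolynomial (Fin n) K) :=
  RingHom.ker (toricMap K A)

/-- For a prime `q`, the ideal `J R_q ∩ R` of `R`: the contraction of the extension of `J` to the
localization of `R` at `q`. -/
noncomputable def localContraction {R : Type*} [CommRing R] (J q : Ideal R) [q.IsPrime] : Ideal R :=
  (J.map (algebraMap R (Localization.AtPrime q))).comap (algebraMap R (Localization.AtPrime q))

/-- The `k`-th symbolic power `I^(k) = ⋂ (I ^ k R_q ∩ R)`, the intersection being over the minimal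
primes `q` of `I`. -/
noncomputable def symbolicPower {R : Type*} [CommRing R] (I : Ideal R) (k : ℕ) : Ideal R :=
  ⨅ q : I.minimalPrimes,
    haveI : (q : Ideal R).IsPrime := q.2.1.1
    localContraction (I ^ k) (q : Ideal R)

/-- The saturation `I : g^∞ = {f ∣ f * g ^ a ∈ I for some a}`. -/
def saturation {R : Type*} [CommRing R] (I : Ideal R) (g : R) : Ideal R where
  carrier := {f | ∃ a : ℕ, f * g ^ a ∈ I}
  zero_mem' := ⟨0, by simp⟩
  add_mem' := by
    rintro x y ⟨a, ha⟩ ⟨b, hb⟩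
    refine ⟨a + b, ?_⟩
    have h : (x + y) * g ^ (a + b) = g ^ b * (x * g ^ a) + g ^ a * (y * g ^ b) := by ring
    rw [h]
    exact I.add_mem (I.mul_mem_left _ ha) (I.mul_mem_left _ hb)
  smul_mem' := by
    rintro c x ⟨a, ha⟩
    refine ⟨a, ?_⟩
    rw [smul_eq_mul, mul_assoc]
    exact I.mul_mem_left _ ha

end ToricSymbolic

/-!
Write `I` for the toric ideal, `g` for the product of the variables and `L ⊆ ℤⁿ` for the integer
kernel of `A`. As `I` is prime, `f` lies in the second symbolic power iff `s * f ∈ I ^ 2` for some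
`s ∉ I`. Since `g ∉ I`, the saturation is contained in the symbolic power.

For the converse, let `s * f ∈ I ^ 2` with `s ∉ I`. Then `f ∈ I`, and the product rule shows that
`eᵢ ∂f/∂eᵢ ∈ I` for all `i` (`derivation_apply_mem_of_mul_mem_sq`). Write `f = ∑ c u * e ^ u`.
Looking at one coefficient of the images under `φ_A` at a time, these conditions say that
`∑ c u = 0` and `∑ c u * u = 0` in `Kⁿ`, both sums over the `u` with a given value of `A u`.

Now invert all the variables and let `J` be the extension of `I`. For `l ∈ L` the element
`e ^ l - 1` lies in `J`, and `l ↦ e ^ l - 1` is additive modulo `J ^ 2`, so it extends to `K ⊗ L`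
(`tensorToQuotient`). If `v` is one exponent with `A v = w`, the part of `f` of degree `w` is
`e ^ v` times the image of `∑ c u ⊗ (u - v)`. This tensor vanishes, because `K ⊗ L → Kⁿ` is
injective in characteristic zero (`sum_tmul_eq_zero`). Hence `f ∈ J ^ 2`
(`algebraMap_mem_torusIdeal_sq`), that is, `f * g ^ a ∈ I ^ 2` for some `a`.
-/

namespace ToricSymbolic

open MvPolynomial TensorProduct

/-! ### The toric map in coordinates -/

section ToricMap

variable {K : Type*} [Field K] {m n : ℕ} (A : Matrix (Fin m) (Fin n) ℕ)

/-- The exponent `A u` of the monomial `φ_A(e ^ u)`. -/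
noncomputable def multidegree (u : Fin n →₀ ℕ) : Fin m →₀ ℕ :=
  Finsupp.equivFunOnFinite.symm (A.mulVec u)

lemma multidegree_apply (u : Fin n →₀ ℕ) (j : Fin m) :
    multidegree A u j = ∑ i, A j i * u i := rfl

lemma toricMap_monomial (u : Fin n →₀ ℕ) (c : K) :
    toricMap K A (monomial u c) = monomial (multidegree A u) c := by
  rw [toricMap, aeval_monomial, monomial_eq, Finsupp.prod_fintype _ _ (by simp),
    Finsupp.prod_fintype _ _ (by simp), algebraMap_eq]
  congr 1
  simp_rw [← Finset.prod_pow, multidegree_apply, ← pow_mul]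
  rw [Finset.prod_comm]
  exact Finset.prod_congr rfl fun j _ => Finset.prod_pow_eq_pow_sum _ _ _

lemma coeff_toricMap (f : MvPolynomial (Fin n) K) (w : Fin m →₀ ℕ) :
    coeff w (toricMap K A f) = ∑ u ∈ f.support with multidegree A u = w, coeff u f := by
  conv_lhs => rw [f.as_sum, map_sum, coeff_sum]
  simp_rw [toricMap_monomial, coeff_monomial, Finset.sum_filter]

lemma X_mul_pderiv_eq_sum (f : MvPolynomial (Fin n) K) (i : Fin n) :
    X i * pderiv i f = ∑ u ∈ f.support, monomial u (coeff u f * u i) := by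
  conv_lhs => rw [f.as_sum, map_sum, Finset.mul_sum]
  refine Finset.sum_congr rfl fun u _ => ?_
  rw [X_mul_pderiv_monomial, ← map_nsmul, nsmul_eq_mul, mul_comm]

lemma coeff_toricMap_X_mul_pderiv (f : MvPolynomial (Fin n) K) (i : Fin n) (w : Fin m →₀ ℕ) :
    coeff w (toricMap K A (X i * pderiv i f)) =
      ∑ u ∈ f.support with multidegree A u = w, coeff u f * u i := by
  rw [X_mul_pderiv_eq_sum, map_sum, coeff_sum]
  simp_rw [toricMap_monomial, coeff_monomial, Finset.sum_filter]

lemma mem_toricIdeal {f : MvPolynomial (Fin n) K} : f ∈ toricIdeal K A ↔ toricMap K A f = 0 :=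
  Iff.rfl

instance toricIdeal_isPrime : (toricIdeal K A).IsPrime := RingHom.ker_isPrime _

lemma prod_X_notMem_toricIdeal :
    (∏ i : Fin n, (X i : MvPolynomial (Fin n) K)) ∉ toricIdeal K A := by
  simp [mem_toricIdeal, toricMap, Finset.prod_eq_zero_iff]

end ToricMap

/-! ### Symbolic powers of prime ideals and derivations -/

section Saturation

variable {R : Type*} [CommRing R]

lemma mem_symbolicPower_iff_of_isPrime {I : Ideal R} [hI : I.IsPrime] {k : ℕ} {f : R} :
    f ∈ symbolicPower I k ↔ ∃ s ∉ I, s * f ∈ I ^ k := by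
  have key (q : Ideal R) [q.IsPrime] :
      f ∈ localContraction (I ^ k) q ↔ ∃ s ∉ q, s * f ∈ I ^ k := by
    rw [localContraction, Ideal.mem_comap,
      IsLocalization.algebraMap_mem_map_algebraMap_iff q.primeCompl]
    rfl
  rw [symbolicPower, Ideal.mem_iInf]
  constructor
  · intro h
    have hmem : I ∈ I.minimalPrimes := by
      rw [Ideal.minimalPrimes_eq_subsingleton_self]; rfl
    exact (key I).1 (h ⟨I, hmem⟩)
  · rintro h ⟨q, hq⟩
    have hqI : q = I := by
      rwa [Ideal.minimalPrimes_eq_subsingleton_self] at hq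
    subst hqI
    exact (key q).2 h

/-- A derivation maps `I ^ 2` into `I`. Hence if `s * f ∈ I ^ 2` with `s` outside the prime ideal
`I`, the product rule puts `D f` in `I` as soon as `f ∈ I`. -/
lemma derivation_apply_mem_of_mul_mem_sq {k : Type*} [CommRing k] [Algebra k R] {I : Ideal R}
    [hI : I.IsPrime] (D : Derivation k R R) {s f : R} (hs : s ∉ I) (hf : f ∈ I)
    (h : s * f ∈ I ^ 2) : D f ∈ I := by
  have hD : ∀ x ∈ I ^ 2, D x ∈ I := by
    intro x hx
    rw [pow_two] at hx
    refine Submodule.mul_induction_on hx (fun a ha b hb => ?_) fun a b ha hb => ?_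
    · rw [D.leibniz]
      exact I.add_mem (I.mul_mem_right _ ha) (I.mul_mem_right _ hb)
    · rw [map_add]
      exact I.add_mem ha hb
  have h2 := hD _ h
  rw [D.leibniz, smul_eq_mul, smul_eq_mul] at h2
  exact (hI.mem_or_mem ((I.add_mem_iff_left (I.mul_mem_right _ hf)).1 h2)).resolve_left hs

end Saturation

/-! ### The toric ideal on the torus -/

section Torus

variable {K : Type*} [Field K] {m n : ℕ} (A : Matrix (Fin m) (Fin n) ℕ)

/-- The lattice of integer vectors in the kernel of `A`. -/
def kernelLattice : Submodule ℤ (Fin n → ℤ) :=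
  LinearMap.ker (A.map (Nat.cast : ℕ → ℤ)).mulVecLin

lemma mem_kernelLattice {l : Fin n → ℤ} :
    l ∈ kernelLattice A ↔ ∀ j, ∑ i, (A j i : ℤ) * l i = 0 := by
  rw [kernelLattice, LinearMap.mem_ker, Matrix.mulVecLin_apply, funext_iff]
  rfl

lemma sub_mem_kernelLattice {u v : Fin n →₀ ℕ} :
    (fun i => (u i : ℤ) - v i) ∈ kernelLattice A ↔ multidegree A u = multidegree A v := by
  rw [mem_kernelLattice, DFunLike.ext_iff]
  refine forall_congr' fun j => ?_
  simp_rw [multidegree_apply, mul_sub, Finset.sum_sub_distrib, sub_eq_zero]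
  exact_mod_cast Iff.rfl

/-- The coordinate ring of the torus: the polynomial ring with all variables inverted. -/
abbrev TorusRing (K : Type*) [Field K] (n : ℕ) : Type _ :=
  Localization.Away (∏ i : Fin n, (X i : MvPolynomial (Fin n) K))

/-- The variable `eᵢ`, as a unit of the coordinate ring of the torus. -/
noncomputable def unitX (K : Type*) [Field K] {n : ℕ} (i : Fin n) : (TorusRing K n)ˣ :=
  (isUnit_of_dvd_unit (map_dvd _ (Finset.dvd_prod_of_mem X (Finset.mem_univ i)))
    (IsLocalization.Away.algebraMap_isUnit
      (∏ i : Fin n, (X i : MvPolynomial (Fin n) K)))).unit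

/-- The Laurent monomial `e ^ l`. -/
noncomputable def laurentMonomial (K : Type*) [Field K] {n : ℕ} (l : Fin n → ℤ) :
    (TorusRing K n)ˣ :=
  ∏ i, unitX K i ^ l i

lemma laurentMonomial_add (l l' : Fin n → ℤ) :
    laurentMonomial K (l + l') = laurentMonomial K l * laurentMonomial K l' := by
  simp [laurentMonomial, zpow_add, Finset.prod_mul_distrib]

lemma laurentMonomial_natCast (u : Fin n →₀ ℕ) :
    (laurentMonomial K (fun i => (u i : ℤ)) : TorusRing K n) =
      algebraMap (MvPolynomial (Fin n) K) (TorusRing K n) (monomial u 1) := by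
  rw [monomial_eq, Finsupp.prod_fintype _ _ (by simp)]
  simp [laurentMonomial, unitX]

lemma algebraMap_monomial_eq_mul_laurentMonomial (u v : Fin n →₀ ℕ) :
    algebraMap (MvPolynomial (Fin n) K) (TorusRing K n) (monomial u 1) =
      algebraMap (MvPolynomial (Fin n) K) (TorusRing K n) (monomial v 1) *
        laurentMonomial K (fun i => (u i : ℤ) - v i) := by
  rw [← laurentMonomial_natCast, ← laurentMonomial_natCast, ← Units.val_mul,
    ← laurentMonomial_add]
  congr 2
  ext i
  simp

variable (K) in
/-- The ideal generated by `I_A` in the coordinate ring of the torus. -/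
noncomputable def torusIdeal :
    Ideal (TorusRing K n) :=
  (toricIdeal K A).map (algebraMap (MvPolynomial (Fin n) K) (TorusRing K n))

lemma laurentMonomial_sub_one_mem {l : Fin n → ℤ} (hl : l ∈ kernelLattice A) :
    (laurentMonomial K l : TorusRing K n) - 1 ∈ torusIdeal K A := by
  -- The positive and negative parts of `l`.
  let u : Fin n →₀ ℕ := Finsupp.equivFunOnFinite.symm fun i => (l i).toNat
  let v : Fin n →₀ ℕ := Finsupp.equivFunOnFinite.symm fun i => (-l i).toNat
  have huv : l = fun i => (u i : ℤ) - v i := by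
    ext i
    simp [u, v]
  rw [huv, sub_mem_kernelLattice] at hl
  have hmem : (monomial u 1 - monomial v 1 : MvPolynomial (Fin n) K) ∈ toricIdeal K A := by
    rw [mem_toricIdeal, map_sub, toricMap_monomial, toricMap_monomial, hl, sub_self]
  have h := Ideal.mem_map_of_mem (algebraMap _ (TorusRing K n)) hmem
  rw [map_sub, algebraMap_monomial_eq_mul_laurentMonomial u v, ← mul_sub_one, ← huv,
    ← laurentMonomial_natCast] at h
  exact (Ideal.unit_mul_mem_iff_mem _ (Units.isUnit _)).1 h

variable (K) in
/-- The map `l ↦ e ^ l - 1` from the kernel lattice to `J / J ^ 2`, regarded inside the quotient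
by `J ^ 2`. It is additive since `(e ^ l - 1) * (e ^ l' - 1) ∈ J ^ 2`. -/
noncomputable def latticeToQuotient :
    kernelLattice A →+ TorusRing K n ⧸ torusIdeal K A ^ 2 :=
  AddMonoidHom.mk'
    (fun l => Ideal.Quotient.mk _ ((laurentMonomial K (l : Fin n → ℤ) : TorusRing K n) - 1)) <| by
    intro l l'
    rw [← map_add, Ideal.Quotient.eq, pow_two]
    convert Ideal.mul_mem_mul (laurentMonomial_sub_one_mem (K := K) A l.2)
      (laurentMonomial_sub_one_mem A l'.2) using 1
    rw [Submodule.coe_add, laurentMonomial_add, Units.val_mul]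
    ring

variable (K) in
/-- The extension of `latticeToQuotient` to `K ⊗ ker A`. -/
noncomputable def tensorToQuotient :
    K ⊗[ℤ] kernelLattice A →+ TorusRing K n ⧸ torusIdeal K A ^ 2 :=
  TensorProduct.liftAddHom
    ((AddMonoidHom.mul.compl₂ (latticeToQuotient K A)).comp
      (((Ideal.Quotient.mk (torusIdeal K A ^ 2)).comp (algebraMap _ (TorusRing K n))).comp
        (C : K →+* MvPolynomial (Fin n) K)).toAddMonoidHom) <| by
    intro r c l
    rw [map_zsmul, map_zsmul, AddMonoidHom.smul_apply]

lemma tensorToQuotient_tmul (c : K) (l : kernelLattice A) :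
    tensorToQuotient K A (c ⊗ₜ l) = Ideal.Quotient.mk _
      (algebraMap (MvPolynomial (Fin n) K) (TorusRing K n) (C c) *
        ((laurentMonomial K (l : Fin n → ℤ) : TorusRing K n) - 1)) := by
  simp [tensorToQuotient, latticeToQuotient]

/-- The natural map `K ⊗ ker A → Kⁿ` is injective: it is the base change of an inclusion along
`ℤ → K`, which is flat because `K` has characteristic zero. -/
lemma sum_tmul_eq_zero [CharZero K] {ι : Type*} (s : Finset ι) (c : ι → K)
    (l : ι → kernelLattice A) (h : ∀ i, ∑ a ∈ s, c a * ((l a : Fin n → ℤ) i : K) = 0) :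
    ∑ a ∈ s, c a ⊗ₜ[ℤ] l a = 0 := by
  apply Module.Flat.lTensor_preserves_injective_linearMap (M := K) (kernelLattice A).subtype
    (kernelLattice A).subtype_injective
  apply (TensorProduct.piScalarRight ℤ ℤ K (Fin n)).injective
  ext i
  simpa [map_sum, TensorProduct.piScalarRight_apply, mul_comm] using h i

/-- The case of a polynomial homogeneous for the grading by `ℕ ^ m`: if its coefficients `c u`
satisfy `∑ c u = 0` and `∑ c u * u = 0`, it lies in `J ^ 2`. -/
lemma sum_monomial_mem_torusIdeal_sq [CharZero K] (s : Finset (Fin n →₀ ℕ))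
    (c : (Fin n →₀ ℕ) → K) (w : Fin m →₀ ℕ) (hs : ∀ u ∈ s, multidegree A u = w)
    (h0 : ∑ u ∈ s, c u = 0) (h1 : ∀ i, ∑ u ∈ s, c u * u i = 0) :
    algebraMap (MvPolynomial (Fin n) K) (TorusRing K n) (∑ u ∈ s, monomial u (c u)) ∈
      torusIdeal K A ^ 2 := by
  obtain rfl | ⟨v, hv⟩ := s.eq_empty_or_nonempty
  · simp
  let l (u : s) : kernelLattice A := ⟨fun i => (u.1 i : ℤ) - v i,
    (sub_mem_kernelLattice A).2 ((hs u u.2).trans (hs v hv).symm)⟩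
  have hzero : ∑ u ∈ s.attach, c u ⊗ₜ[ℤ] l u = 0 := by
    refine sum_tmul_eq_zero A _ _ _ fun i => ?_
    rw [Finset.sum_attach s fun u => c u * (((u i : ℤ) - v i : ℤ) : K)]
    simp [mul_sub, Finset.sum_sub_distrib, h1, ← Finset.sum_mul, h0]
  have hmem := congrArg (tensorToQuotient K A) hzero
  rw [map_sum, map_zero] at hmem
  simp_rw [tensorToQuotient_tmul] at hmem
  rw [← map_sum, Ideal.Quotient.eq_zero_iff_mem] at hmem
  let ι := algebraMap (MvPolynomial (Fin n) K) (TorusRing K n)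
  convert Ideal.mul_mem_left _ (ι (monomial v 1)) hmem using 1
  rw [Finset.mul_sum, Finset.sum_attach s fun u => ι (monomial v 1) *
    (ι (C (c u)) *
      ((laurentMonomial K (fun i => (u i : ℤ) - v i) : TorusRing K n) - 1))]
  -- The terms with `e ^ v` cancel in the sum, since `∑ c u = 0`.
  have hterm (u : Fin n →₀ ℕ) : ι (monomial v 1) *
      (ι (C (c u)) *
        ((laurentMonomial K (fun i => (u i : ℤ) - v i) : TorusRing K n) - 1)) =
      ι (monomial u (c u)) -
        ι (monomial v 1) * ι (C (c u)) := by
    have hu : monomial u (c u) = C (c u) * monomial u 1 := by rw [C_mul_monomial, mul_one]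
    rw [hu, map_mul, show ι (monomial u 1) = _ from algebraMap_monomial_eq_mul_laurentMonomial u v]
    ring
  simp_rw [hterm]
  rw [Finset.sum_sub_distrib, ← Finset.mul_sum, ← map_sum ι, ← map_sum ι, ← map_sum C, h0,
    map_zero, map_zero, mul_zero, sub_zero]

/-- If `f` and all `eᵢ ∂f/∂eᵢ` lie in `I_A`, then `f` lies in `J ^ 2`. -/
lemma algebraMap_mem_torusIdeal_sq [CharZero K] {f : MvPolynomial (Fin n) K}
    (hf : f ∈ toricIdeal K A) (hD : ∀ i, X i * pderiv i f ∈ toricIdeal K A) :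
    algebraMap (MvPolynomial (Fin n) K) (TorusRing K n) f ∈ torusIdeal K A ^ 2 := by
  classical
  rw [f.as_sum, ← Finset.sum_fiberwise_of_maps_to
    (fun u hu => Finset.mem_image_of_mem (multidegree A) hu), map_sum]
  refine Ideal.sum_mem _ fun w _ => sum_monomial_mem_torusIdeal_sq A _ _ w
    (fun u hu => (Finset.mem_filter.1 hu).2) ?_ fun i => ?_
  · have h := coeff_toricMap A f w
    rw [(mem_toricIdeal A).1 hf, coeff_zero] at h
    convert h.symm
  · have h := coeff_toricMap_X_mul_pderiv A f i w
    rw [(mem_toricIdeal A).1 (hD i), coeff_zero] at h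
    convert h.symm

end Torus

end ToricSymbolic

/-- Over an algebraically closed field of characteristic zero, the second symbolic power of a toric
ideal is the saturation of its square by the product of all the variables. -/
theorem theoremt {K : Type*} [Field K] [IsAlgClosed K] [CharZero K] {m n : ℕ}
    (A : Matrix (Fin m) (Fin n) ℕ) (hA : ∀ i : Fin n, A.col i ≠ 0) :
    ToricSymbolic.saturation (ToricSymbolic.toricIdeal K A ^ 2)
        (∏ i : Fin n, (MvPolynomial.X i : MvPolynomial (Fin n) K)) =
      ToricSymbolic.symbolicPower (ToricSymbolic.toricIdeal K A) 2 := by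
  open ToricSymbolic in
  set g := ∏ i : Fin n, (MvPolynomial.X i : MvPolynomial (Fin n) K)
  have hprime := toricIdeal_isPrime (K := K) A
  ext f
  rw [mem_symbolicPower_iff_of_isPrime]
  constructor
  · rintro ⟨a, ha⟩
    exact ⟨g ^ a, fun h => prod_X_notMem_toricIdeal A (hprime.mem_of_pow_mem a h),
      mul_comm f (g ^ a) ▸ ha⟩
  · rintro ⟨s, hs, hsf⟩
    have hf : f ∈ toricIdeal K A :=
      (hprime.mem_or_mem (Ideal.pow_le_self two_ne_zero hsf)).resolve_left hs
    have hmem := algebraMap_mem_torusIdeal_sq A hf fun i => Ideal.mul_mem_left _ _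
      (derivation_apply_mem_of_mul_mem_sq (MvPolynomial.pderiv i) hs hf hsf)
    rw [torusIdeal, ← Ideal.map_pow,
      IsLocalization.algebraMap_mem_map_algebraMap_iff (Submonoid.powers g)] at hmem
    obtain ⟨_, ⟨a, rfl⟩, ha⟩ := hmem
    exact ⟨a, mul_comm f (g ^ a) ▸ ha⟩
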